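/- Let $m>1$ be a fixed integer. Let $(G_m^n)_{n\ge 0}$ be the Bollobás–Riordan preferential attachment multigraphs: $G_m^0$ is empty, and $G_m^n$, with vertex set $\{1,\dots,n\}$ and $mn$ edges, is obtained from $G_m^{n-1}$ by adding the vertex $n$ and then $m$ edges emanating from $n$, one at a time; the other end of each new edge is a random vertex of $\{1,\dots,n\}$, chosen with probability proportional to the current degree, where a loop contributes $2$ to the degree, the edges added previously (including the earlier ones of the same vertex) count, and the outward half (at $n$) of the edge being added already counts towards the degree of $n$. Then for every $\varepsilon>0$, as $n\to\infty$, \[ \mathbb P(G_m^n\text{ is connected})=1-O\left(\left(\frac{(\log\log n)^{1+\varepsilon}}{\log n}\right)^{\frac{m-1}{3}}\right), \] where the implied constant may depend on $m$ and $\varepsilon$. -/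

import Mathlib

open Filter Asymptotics

noncomputable section

namespace PrefAttach

/-- A finite multigraph with natural numbers as vertex labels, given by its multiset of edges.
An unordered pair `s(u, u)` is a loop at `u`; an edge may be repeated (parallel edges). -/
abbrev Multigraph : Type := Multiset (Sym2 ℕ)

/-- The multiset of half-edges of `G`, each recorded by the vertex it is incident to. The
multiplicity of `v` is the degree of `v` in `G`, a loop at `v` contributing `2`. -/
def halfEdges (G : Multigraph) : Multiset ℕ := G.bind Sym2.toMultiset

/-- One preferential attachment step: a single new edge with one end at `v` is added to `G`. Its
other end is a random vertex, chosen with probability proportional to the degree, where the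
outward half (at `v`) of the edge that is being added already counts for the degree of `v`. So a
vertex `u ≠ v` is chosen with probability `deg u / (2 |E(G)| + 1)`, and a loop at `v` arises with
probability `(deg v + 1) / (2 |E(G)| + 1)`. -/
def addEdge (v : ℕ) (G : Multigraph) : PMF Multigraph :=
  (PMF.ofMultiset (v ::ₘ halfEdges G) (Multiset.cons_ne_zero)).map fun u => s(v, u) ::ₘ G

/-- `k` edges emanating from `v` are added to `G` one at a time, each according to `addEdge`
applied to the current multigraph. -/
def addEdges (v : ℕ) : ℕ → Multigraph → PMF Multigraph
  | 0, G => PMF.pure G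
  | k + 1, G => (addEdge v G).bind (addEdges v k)

/-- The law of the preferential attachment multigraph with `n` vertices, labelled
`0, 1, …, n - 1` in the order of their arrival, and `m * n` edges: each newcomer `n` brings `m`
edges emanating from it. -/
def prefGraph (m : ℕ) : ℕ → PMF Multigraph
  | 0 => PMF.pure 0
  | n + 1 => (prefGraph m n).bind (addEdges n m)

/-- The adjacency structure of `G` on the vertex set `{0, …, n - 1}`: distinct `u`, `v` are adjacent
if `G` has an edge that joins them. -/
def adjGraph (n : ℕ) (G : Multigraph) : SimpleGraph (Fin n) where
  Adj u v := u ≠ v ∧ s((u : ℕ), (v : ℕ)) ∈ G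
  symm := ⟨fun u v h => ⟨h.1.symm, by rw [Sym2.eq_swap]; exact h.2⟩⟩
  loopless := ⟨fun _ h => h.1 rfl⟩

/-- The probability that the preferential attachment multigraph with `n` vertices and `m` edges
emanating from each vertex is connected. -/
def probConnected (m n : ℕ) : ℝ :=
  ((prefGraph m n).toOuterMeasure {G | (adjGraph n G).Connected}).toReal

end PrefAttach

end

open scoped ENNReal

namespace PrefAttach

/-! ### Expectations of nonnegative functions -/

/-! Let X be the number of components minus one; by Markov, disconnection has probability at most E
X. Write D = 2mn for the total degree when vertex n arrives. If its first edge goes to an old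
vertex, X has not grown, and each component avoiding n carries a half-edge, so the second edge
multiplies E X by at most (D+2)/(D+3). The first edge is a loop with probability only 1/(D+1), and
then X grows only if the second is a loop too, with probability 3/(D+3). Further edges never
increase X.

Averaging gives `expect_addEdges_excess_succ_le`: a contraction by about 1 - 1/D plus an error of
order 1/D². Induction (`recurrence_bound`, `expect_excess_le`) yields E X ≤ 10 n^(-1/(10m)), a power
of n, which beats every power of log n. -/

/-- The expectation of a nonnegative function under a probability mass function. -/
noncomputable def expect {α : Type*} (p : PMF α) (f : α → ℝ≥0∞) : ℝ≥0∞ := ∑' a, p a * f a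

theorem expect_pure {α : Type*} (a : α) (f : α → ℝ≥0∞) : expect (PMF.pure a) f = f a := by
  rw [expect, tsum_eq_single a]
  · simp
  · intro b hb
    simp [PMF.pure_apply, hb]

theorem expect_bind {α β : Type*} (p : PMF α) (q : α → PMF β) (f : β → ℝ≥0∞) :
    expect (p.bind q) f = expect p fun a => expect (q a) f := by
  simp only [expect, PMF.bind_apply, ← ENNReal.tsum_mul_right, ← ENNReal.tsum_mul_left]
  rw [ENNReal.tsum_comm]
  simp only [mul_assoc]

theorem expect_map {α β : Type*} (p : PMF α) (g : α → β) (f : β → ℝ≥0∞) :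
    expect (p.map g) f = expect p fun a => f (g a) := by
  rw [← PMF.bind_pure_comp, expect_bind]
  simp [expect_pure]

theorem expect_mono {α : Type*} {p : PMF α} {f g : α → ℝ≥0∞} (h : ∀ a ∈ p.support, f a ≤ g a) :
    expect p f ≤ expect p g := by
  refine ENNReal.tsum_le_tsum fun a => ?_
  by_cases ha : a ∈ p.support
  · exact mul_le_mul_right (h a ha) _
  · simp [(PMF.apply_eq_zero_iff p a).2 ha]

theorem expect_const {α : Type*} (p : PMF α) (c : ℝ≥0∞) : expect p (fun _ => c) = c := by
  rw [expect, ENNReal.tsum_mul_right, PMF.tsum_coe, one_mul]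

theorem expect_add {α : Type*} (p : PMF α) (f g : α → ℝ≥0∞) :
    expect p (fun a => f a + g a) = expect p f + expect p g := by
  simp only [expect, mul_add, ENNReal.tsum_add]

theorem expect_const_mul {α : Type*} (p : PMF α) (c : ℝ≥0∞) (f : α → ℝ≥0∞) :
    expect p (fun a => c * f a) = c * expect p f := by
  simp only [expect, mul_left_comm _ c, ENNReal.tsum_mul_left]

theorem expect_ofMultiset_le {α : Type*} (s : Multiset α) (hs : s ≠ 0) {f : α → ℝ≥0∞} {r : α → ℝ}
    (hr : ∀ a ∈ s, 0 ≤ r a) (hf : ∀ a ∈ s, f a ≤ ENNReal.ofReal (r a)) :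
    expect (PMF.ofMultiset s hs) f ≤ ENNReal.ofReal ((s.map r).sum / s.card) := by
  classical
  have hcard : (0 : ℝ) < s.card := by exact_mod_cast Multiset.card_pos.2 hs
  have hzero : ∀ a ∉ s.toFinset, PMF.ofMultiset s hs a * f a = 0 := by
    intro a ha
    rw [PMF.ofMultiset_apply_of_notMem hs (by simpa using ha), zero_mul]
  rw [expect, tsum_eq_sum hzero, Finset.sum_multiset_map_count, Finset.sum_div,
    ENNReal.ofReal_sum_of_nonneg]
  · refine Finset.sum_le_sum fun a ha => ?_
    have ha' : a ∈ s := by simpa using ha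
    rw [nsmul_eq_mul, mul_div_right_comm, ENNReal.ofReal_mul (by positivity),
      ENNReal.ofReal_div_of_pos hcard, ENNReal.ofReal_natCast, ENNReal.ofReal_natCast,
      PMF.ofMultiset_apply]
    exact mul_le_mul' (by convert le_rfl) (hf a ha')
  · intro a ha
    have := hr a (by simpa using ha)
    positivity

/-! ### Counting components -/

/-- The simple graph on `ℕ` underlying a multigraph. -/
def edgeGraph (G : Multigraph) : SimpleGraph ℕ := SimpleGraph.fromEdgeSet {e | e ∈ G}

theorem edgeGraph_adj {G : Multigraph} {u v : ℕ} : (edgeGraph G).Adj u v ↔ s(u, v) ∈ G ∧ u ≠ v := by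
  simp [edgeGraph]

theorem edgeGraph_le_cons (e : Sym2 ℕ) (G : Multigraph) : edgeGraph G ≤ edgeGraph (e ::ₘ G) :=
  SimpleGraph.fromEdgeSet_mono fun _ h => Multiset.mem_cons_of_mem h

theorem edgeGraph_cons_loop (v : ℕ) (G : Multigraph) : edgeGraph (s(v, v) ::ₘ G) = edgeGraph G := by
  ext a b
  simp only [edgeGraph_adj, Multiset.mem_cons]
  aesop

open Classical in
/-- The set of components that meet `{0, …, n - 1}`. -/
noncomputable def comps (n : ℕ) (G : Multigraph) : Finset (edgeGraph G).ConnectedComponent :=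
  (Finset.range n).image (edgeGraph G).connectedComponentMk

/-- The number of components that meet `{0, …, n - 1}`, minus one. -/
noncomputable def excess (n : ℕ) (G : Multigraph) : ℕ := (comps n G).card - 1

theorem mem_comps {n : ℕ} {G : Multigraph} {u : ℕ} (h : u < n) :
    (edgeGraph G).connectedComponentMk u ∈ comps n G :=
  by
  classical exact Finset.mem_image.2 ⟨u, Finset.mem_range.2 h, rfl⟩

theorem card_comps_pos {n : ℕ} (G : Multigraph) (hn : 0 < n) : 0 < (comps n G).card :=
  Finset.card_pos.2 ⟨_, mem_comps hn⟩

-- Writing the new components as an image reduces merging to non-injectivity: cardinality never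
-- rises, and it drops as soon as two components are identified.
open Classical in
theorem comps_cons (n : ℕ) (e : Sym2 ℕ) (G : Multigraph) :
    comps n (e ::ₘ G) =
      (comps n G).image (SimpleGraph.ConnectedComponent.map
        (SimpleGraph.Hom.ofLE (edgeGraph_le_cons e G))) := by
  simp only [comps, Finset.image_image]
  rfl

theorem excess_cons_le (n : ℕ) (e : Sym2 ℕ) (G : Multigraph) : excess n (e ::ₘ G) ≤ excess n G := by
  classical
  unfold excess
  rw [comps_cons]
  exact Nat.sub_le_sub_right Finset.card_image_le 1

theorem card_comps_cons_add_one_le {n u v : ℕ} {G : Multigraph} (hu : u < n) (hv : v < n)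
    (h : ¬ (edgeGraph G).Reachable v u) :
    (comps n (s(v, u) ::ₘ G)).card + 1 ≤ (comps n G).card := by
  classical
  have hvu : v ≠ u := fun hh => h (hh ▸ SimpleGraph.Reachable.refl _)
  have hne : (edgeGraph G).connectedComponentMk v ≠ (edgeGraph G).connectedComponentMk u :=
    fun hh => h (SimpleGraph.ConnectedComponent.exact hh)
  rw [comps_cons]
  refine Nat.succ_le_of_lt (lt_of_le_of_ne Finset.card_image_le fun hcard => hne ?_)
  refine Finset.card_image_iff.1 hcard (mem_comps hv) (mem_comps hu) ?_
  refine SimpleGraph.ConnectedComponent.sound (SimpleGraph.Adj.reachable ?_)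
  exact edgeGraph_adj.2 ⟨Multiset.mem_cons_self _ _, hvu⟩

theorem excess_cons_add_one_le {n u v : ℕ} {G : Multigraph} (hu : u < n) (hv : v < n)
    (h : ¬ (edgeGraph G).Reachable v u) : excess n (s(v, u) ::ₘ G) + 1 ≤ excess n G := by
  have h1 := card_comps_cons_add_one_le hu hv h
  have h2 := card_comps_pos (s(v, u) ::ₘ G) (Nat.zero_lt_of_lt hu)
  unfold excess
  omega

theorem excess_succ_le {n : ℕ} (hn : 0 < n) (G : Multigraph) : excess (n + 1) G ≤ excess n G + 1 := by
  classical
  have h1 : (comps (n + 1) G).card ≤ (comps n G).card + 1 := by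
    unfold comps
    rw [Finset.range_add_one, Finset.image_insert]
    exact Finset.card_insert_le _ _
  have h2 := card_comps_pos G hn
  unfold excess
  omega

theorem excess_one (G : Multigraph) : excess 1 G = 0 := by
  simp [excess, comps]

theorem halfEdges_cons (u v : ℕ) (G : Multigraph) :
    halfEdges (s(u, v) ::ₘ G) = u ::ₘ v ::ₘ halfEdges G := by
  have h : (s(u, v) : Sym2 ℕ).toMultiset = {u, v} := rfl
  rw [halfEdges, Multiset.cons_bind, h, Multiset.insert_eq_cons, Multiset.cons_add,
    Multiset.singleton_add, halfEdges]

theorem mem_halfEdges_of_adj {G : Multigraph} {u v : ℕ} (h : (edgeGraph G).Adj u v) :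
    u ∈ halfEdges G :=
  Multiset.mem_bind.2 ⟨_, (edgeGraph_adj.1 h).1, by simp⟩

-- Every component other than that of `v` contains a vertex that owns a half-edge, and distinct
-- components give distinct such vertices. Only `v` may be isolated.
open Classical in
theorem excess_le_card_filter {n v : ℕ} {G : Multigraph} (hv : v < n)
    (h : ∀ u < n, u = v ∨ u ∈ halfEdges G) :
    excess n G ≤ ((halfEdges G).filter fun u => ¬ (edgeGraph G).Reachable v u).card := by
  have hsub : (comps n G).erase ((edgeGraph G).connectedComponentMk v) ⊆
      ((halfEdges G).filter fun u => ¬ (edgeGraph G).Reachable v u).toFinset.image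
        (edgeGraph G).connectedComponentMk := by
    intro c hc
    obtain ⟨hcv, hc⟩ := Finset.mem_erase.1 hc
    obtain ⟨u, hu, rfl⟩ := Finset.mem_image.1 hc
    refine Finset.mem_image_of_mem _ ?_
    have hr : ¬ (edgeGraph G).Reachable v u :=
      fun hr => hcv (SimpleGraph.ConnectedComponent.sound hr.symm)
    rw [Multiset.mem_toFinset, Multiset.mem_filter]
    refine ⟨(h u (Finset.mem_range.1 hu)).resolve_left ?_, hr⟩
    rintro rfl
    exact hr (SimpleGraph.Reachable.refl _)
  calc excess n G = ((comps n G).erase ((edgeGraph G).connectedComponentMk v)).card :=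
        (Finset.card_erase_of_mem (mem_comps hv)).symm
    _ ≤ _ := Finset.card_le_card hsub
    _ ≤ _ := Finset.card_image_le
    _ ≤ _ := Multiset.toFinset_card_le _

theorem sum_excess_cons_add_le {n v : ℕ} {G : Multigraph} (hv : v < n)
    (h : ∀ u < n, u = v ∨ u ∈ halfEdges G) (h' : ∀ u ∈ halfEdges G, u < n) :
    ((v ::ₘ halfEdges G).map fun u => excess n (s(v, u) ::ₘ G)).sum + excess n G ≤
      ((halfEdges G).card + 1) * excess n G := by
  classical
  -- The multiset is freed from `G` for the induction; each half-edge out of reach of `v` saves one.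
  have key : ∀ s : Multiset ℕ, (∀ u ∈ s, u < n) →
      (s.map fun u => excess n (s(v, u) ::ₘ G)).sum +
        (s.filter fun u => ¬ (edgeGraph G).Reachable v u).card ≤ s.card * excess n G := by
    intro s
    induction s using Multiset.induction_on with
    | empty => simp
    | cons u s ih =>
      intro hs
      have h1 := ih fun w hw => hs w (Multiset.mem_cons_of_mem hw)
      by_cases hr : (edgeGraph G).Reachable v u
      · have h2 := excess_cons_le n s(v, u) G
        simp only [Multiset.map_cons, Multiset.sum_cons, Multiset.card_cons]
        rw [Multiset.filter_cons_of_neg _ (by simpa using hr)]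
        linarith
      · have h2 := excess_cons_add_one_le (hs u (Multiset.mem_cons_self _ _)) hv hr
        simp only [Multiset.map_cons, Multiset.sum_cons, Multiset.card_cons]
        rw [Multiset.filter_cons_of_pos (p := fun u => ¬ (edgeGraph G).Reachable v u) _ hr,
          Multiset.card_cons]
        linarith
  have h1 := key _ h'
  have h2 := excess_le_card_filter hv h
  have h3 := excess_cons_le n s(v, v) G
  simp only [Multiset.map_cons, Multiset.sum_cons]
  linarith

theorem expect_addEdge_excess_le {n v : ℕ} {G : Multigraph} (hv : v < n)
    (h : ∀ u < n, u = v ∨ u ∈ halfEdges G) (h' : ∀ u ∈ halfEdges G, u < n) :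
    expect (addEdge v G) (fun G' => (excess n G' : ℝ≥0∞)) ≤
      ENNReal.ofReal ((halfEdges G).card * excess n G / ((halfEdges G).card + 1)) := by
  rw [addEdge, expect_map]
  refine (expect_ofMultiset_le _ _ (r := fun u => (excess n (s(v, u) ::ₘ G) : ℝ))
    (fun _ _ => by positivity) (fun _ _ => by simp)).trans (ENNReal.ofReal_le_ofReal ?_)
  have h1 := sum_excess_cons_add_le hv h h'
  have h2 : (((v ::ₘ halfEdges G).map fun u => (excess n (s(v, u) ::ₘ G) : ℝ)).sum) =
      ((((v ::ₘ halfEdges G).map fun u => excess n (s(v, u) ::ₘ G)).sum : ℕ) : ℝ) := by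
    rw [Nat.cast_multiset_sum, Multiset.map_map]
    rfl
  rw [h2, Multiset.card_cons]
  push_cast
  gcongr
  have h3 : (((v ::ₘ halfEdges G).map fun u => excess n (s(v, u) ::ₘ G)).sum : ℝ) + excess n G ≤
      ((halfEdges G).card + 1) * excess n G := by exact_mod_cast h1
  push_cast at h3 ⊢
  linarith

/-! ### Connectedness -/

/-- Components are counted in a graph on all of ℕ, but a walk starting below `n` never leaves that
range, so it transfers to `Fin n`. -/
theorem connected_of_excess_eq_zero {n : ℕ} {G : Multigraph} (hn : 0 < n)
    (h : ∀ u ∈ halfEdges G, u < n) (h0 : excess n G = 0) : (adjGraph n G).Connected := by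
  have key : ∀ u v : ℕ, (edgeGraph G).Walk u v → ∀ hu : u < n, ∃ hv : v < n,
      (adjGraph n G).Reachable ⟨u, hu⟩ ⟨v, hv⟩ := by
    intro u v p
    induction p with
    | nil => exact fun hu => ⟨hu, SimpleGraph.Reachable.refl _⟩
    | @cons a b c hab _ ih =>
      intro ha
      obtain ⟨hc, hr⟩ := ih (h b (mem_halfEdges_of_adj hab.symm))
      refine ⟨hc, SimpleGraph.Reachable.trans (SimpleGraph.Adj.reachable ?_) hr⟩
      have := edgeGraph_adj.1 hab
      exact ⟨fun hh => this.2 (Fin.mk.inj_iff.1 hh), this.1⟩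
  have : Nonempty (Fin n) := ⟨⟨0, hn⟩⟩
  refine ⟨fun u v => ?_⟩
  have hcard : (comps n G).card ≤ 1 := by
    unfold excess at h0
    omega
  have huv := Finset.card_le_one.1 hcard _ (mem_comps u.2) _ (mem_comps v.2)
  obtain ⟨p⟩ := SimpleGraph.ConnectedComponent.exact huv
  exact (key _ _ p u.2).2

/-! ### The growth of the graph -/

theorem exists_of_mem_support_addEdge {v : ℕ} {G G' : Multigraph} (h : G' ∈ (addEdge v G).support) :
    ∃ u ∈ v ::ₘ halfEdges G, G' = s(v, u) ::ₘ G := by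
  classical
  rw [addEdge, PMF.support_map] at h
  obtain ⟨u, hu, rfl⟩ := h
  exact ⟨u, by simpa using hu, rfl⟩

theorem halfEdges_of_mem_support_addEdges {n k : ℕ} {G G' : Multigraph}
    (hG : ∀ u ∈ halfEdges G, u ≤ n) (h : G' ∈ (addEdges n k G).support) :
    (halfEdges G').card = (halfEdges G).card + 2 * k ∧ (∀ u ∈ halfEdges G', u ≤ n) ∧
      (∀ u ∈ halfEdges G, u ∈ halfEdges G') ∧ (0 < k → n ∈ halfEdges G') := by
  induction k generalizing G with
  | zero =>
    obtain rfl : G' = G := by simpa [addEdges] using h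
    simpa using hG
  | succ k ih =>
    rw [addEdges, PMF.mem_support_bind_iff] at h
    obtain ⟨G₁, h₁, h₂⟩ := h
    obtain ⟨u, hu, rfl⟩ := exists_of_mem_support_addEdge h₁
    have hun : u ≤ n := by
      rcases Multiset.mem_cons.1 hu with rfl | hu
      · exact le_rfl
      · exact hG u hu
    obtain ⟨a, b, c, -⟩ := ih (by
      intro w hw
      simp only [halfEdges_cons, Multiset.mem_cons] at hw
      rcases hw with rfl | rfl | hw
      exacts [le_rfl, hun, hG w hw]) h₂
    simp only [halfEdges_cons, Multiset.card_cons, Multiset.mem_cons] at a c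
    exact ⟨by omega, b, fun w hw => c w (.inr (.inr hw)), fun _ => c n (.inl rfl)⟩

theorem halfEdges_of_mem_support_prefGraph {m n : ℕ} (hm : 0 < m) {G : Multigraph}
    (h : G ∈ (prefGraph m n).support) :
    (halfEdges G).card = 2 * m * n ∧ ∀ u, u ∈ halfEdges G ↔ u < n := by
  induction n generalizing G with
  | zero =>
    obtain rfl : G = 0 := by simpa [prefGraph] using h
    simp [halfEdges]
  | succ n ih =>
    rw [prefGraph, PMF.mem_support_bind_iff] at h
    obtain ⟨G₁, h₁, h₂⟩ := h
    obtain ⟨hc, hmem⟩ := ih h₁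
    obtain ⟨a, b, c, d⟩ :=
      halfEdges_of_mem_support_addEdges (fun u hu => ((hmem u).1 hu).le) h₂
    refine ⟨by rw [a, hc]; ring, fun u => ⟨fun hu => Nat.lt_succ_of_le (b u hu), fun hu => ?_⟩⟩
    rcases Nat.lt_succ_iff_lt_or_eq.1 hu with hu | rfl
    · exact c u ((hmem u).2 hu)
    · exact d hm

theorem expect_addEdges_excess_le (n v k : ℕ) (G : Multigraph) :
    expect (addEdges v k G) (fun G' => (excess n G' : ℝ≥0∞)) ≤ excess n G := by
  induction k generalizing G with
  | zero => rw [addEdges, expect_pure]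
  | succ k ih =>
    rw [addEdges, expect_bind]
    refine (expect_mono (g := fun _ => (excess n G : ℝ≥0∞)) fun G₁ h₁ => ?_).trans
      (expect_const _ _).le
    obtain ⟨u, -, rfl⟩ := exists_of_mem_support_addEdge h₁
    exact (ih _).trans (by exact_mod_cast excess_cons_le n _ G)

theorem not_reachable_of_notMem_halfEdges {G : Multigraph} {u v : ℕ} (hv : v ∉ halfEdges G)
    (huv : u ≠ v) : ¬ (edgeGraph G).Reachable v u := by
  rintro ⟨p⟩
  cases p with
  | nil => exact huv rfl
  | cons h _ => exact hv (mem_halfEdges_of_adj h)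

/-- The newcomer creates at most one component, and the edge to `u` merges it at once. -/
theorem excess_succ_cons_le {n u : ℕ} {G : Multigraph} (hn : 0 < n) (hG : n ∉ halfEdges G)
    (hu : u < n) : excess (n + 1) (s(n, u) ::ₘ G) ≤ excess n G := by
  have h1 := excess_cons_add_one_le (n := n + 1) (Nat.lt_succ_of_lt hu) n.lt_succ_self
    (not_reachable_of_notMem_halfEdges hG hu.ne)
  have h2 := excess_succ_le hn G
  omega

theorem excess_cons_loop (n v : ℕ) (G : Multigraph) : excess n (s(v, v) ::ₘ G) = excess n G := by
  unfold excess comps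
  rw [edgeGraph_cons_loop]

end PrefAttach

namespace PrefAttach

/-! ### One-step drift of the number of components -/

/-- The 3 counts the half-edges at `n`: two from the loop and the outward half of the second edge.
Only choosing one of these leaves `n` isolated. -/
theorem expect_addEdge_loop_le {n : ℕ} {G : Multigraph} (hn : 0 < n)
    (hG : ∀ u ∈ halfEdges G, u < n) :
    expect (addEdge n (s(n, n) ::ₘ G)) (fun G' => (excess (n + 1) G' : ℝ≥0∞)) ≤
      ENNReal.ofReal (excess n G + 3 / ((halfEdges G).card + 3)) := by
  have hnG : n ∉ halfEdges G := fun h => (hG n h).false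
  rw [addEdge, expect_map]
  refine (expect_ofMultiset_le _ _
    (r := fun u => if u = n then (excess n G : ℝ) + 1 else excess n G)
    (fun u _ => by split_ifs <;> positivity) (fun u hu => ?_)).trans (ENNReal.ofReal_le_ofReal ?_)
  · split_ifs with hun
    · subst hun
      rw [excess_cons_loop, excess_cons_loop, ← Nat.cast_add_one, ENNReal.ofReal_natCast]
      exact_mod_cast excess_succ_le hn G
    · rw [ENNReal.ofReal_natCast]
      have hu' : u ∈ halfEdges G := by simpa [halfEdges_cons, hun] using hu
      have h1 := excess_succ_cons_le hn hnG (hG u hu')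
      have h2 : excess (n + 1) (s(n, u) ::ₘ s(n, n) ::ₘ G) ≤ excess (n + 1) (s(n, u) ::ₘ G) := by
        rw [Multiset.cons_swap]
        exact excess_cons_le _ _ _
      exact_mod_cast h2.trans h1
  · have hsum : ((halfEdges G).map fun u => if u = n then (excess n G : ℝ) + 1 else excess n G) =
        (halfEdges G).map fun _ => (excess n G : ℝ) :=
      Multiset.map_congr rfl fun u hu => if_neg (hG u hu).ne
    simp only [halfEdges_cons, Multiset.map_cons, Multiset.sum_cons, if_true, hsum,
      Multiset.map_const', Multiset.sum_replicate, Multiset.card_cons, nsmul_eq_mul]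
    push_cast
    apply le_of_eq
    field_simp
    ring

theorem expect_addEdge_cons_le {n u : ℕ} {G : Multigraph} (hn : 0 < n)
    (hG : ∀ w, w ∈ halfEdges G ↔ w < n) (hu : u < n) :
    expect (addEdge n (s(n, u) ::ₘ G)) (fun G' => (excess (n + 1) G' : ℝ≥0∞)) ≤
      ENNReal.ofReal (((halfEdges G).card + 2) / ((halfEdges G).card + 3) * excess n G) := by
  have h1 := excess_succ_cons_le hn (fun h => ((hG n).1 h).false) hu
  refine (expect_addEdge_excess_le n.lt_succ_self (fun w hw => ?_) (fun w hw => ?_)).trans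
    (ENNReal.ofReal_le_ofReal ?_)
  · rcases Nat.lt_succ_iff_lt_or_eq.1 hw with hw | rfl
    · exact .inr (by simp [halfEdges_cons, (hG w).2 hw])
    · exact .inl rfl
  · simp only [halfEdges_cons, Multiset.mem_cons, hG] at hw
    omega
  · have h2 : (excess (n + 1) (s(n, u) ::ₘ G) : ℝ) ≤ excess n G := by exact_mod_cast h1
    simp only [halfEdges_cons, Multiset.card_cons]
    push_cast
    rw [mul_div_right_comm]
    refine (mul_le_mul_of_nonneg_left h2 (by positivity)).trans (le_of_eq ?_)
    ring

theorem expect_addEdges_excess_succ_le {n k : ℕ} {G : Multigraph} (hn : 0 < n)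
    (hG : ∀ w, w ∈ halfEdges G ↔ w < n) {D : ℝ} (hD : D = (halfEdges G).card) :
    expect (addEdges n (k + 2) G) (fun G' => (excess (n + 1) G' : ℝ≥0∞)) ≤
      ENNReal.ofReal ((1 - D / ((D + 1) * (D + 3))) * excess n G + 3 / ((D + 1) * (D + 3))) := by
  have hD0 : 0 ≤ D := hD ▸ Nat.cast_nonneg _
  simp only [addEdges, expect_bind]
  -- Only the first two edges are exploited; the other `k` are discarded by monotonicity.
  refine (expect_mono fun G₁ _ => expect_mono fun G₂ _ =>
    expect_addEdges_excess_le (n + 1) n k G₂).trans ?_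
  rw [addEdge, expect_map]
  refine (expect_ofMultiset_le _ _
    (r := fun u => if u = n then excess n G + 3 / (D + 3) else (D + 2) / (D + 3) * excess n G)
    (fun u _ => by split_ifs <;> positivity) (fun u hu => ?_)).trans (ENNReal.ofReal_le_ofReal ?_)
  · rw [hD]
    split_ifs with hun
    · subst hun
      exact expect_addEdge_loop_le hn fun w hw => (hG w).1 hw
    · exact expect_addEdge_cons_le hn hG ((hG u).1 ((Multiset.mem_cons.1 hu).resolve_left hun))
  · have hsum : ((halfEdges G).map fun u =>
          if u = n then excess n G + 3 / (D + 3) else (D + 2) / (D + 3) * excess n G) =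
        (halfEdges G).map fun _ => (D + 2) / (D + 3) * excess n G :=
      Multiset.map_congr rfl fun u hu => if_neg ((hG u).1 hu).ne
    simp only [Multiset.map_cons, Multiset.sum_cons, if_true, hsum,
      Multiset.map_const', Multiset.sum_replicate, Multiset.card_cons, nsmul_eq_mul]
    push_cast
    rw [← hD]
    apply le_of_eq
    field_simp
    ring

/-! ### The expected number of superfluous components -/

/-- Bernoulli for exponents in [0, 1], followed by (1 - x)(1 + x) ≤ 1 with x = δ/t. -/
theorem rpow_neg_mul_one_sub_le {t δ : ℝ} (ht : 0 < t) (h0 : 0 ≤ δ) (h1 : δ ≤ 1) :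
    t ^ (-δ) * (1 - δ / t) ≤ (t + 1) ^ (-δ) := by
  have h2 : t + 1 = t * (1 + 1 / t) := by field_simp
  have h3 : (1 + 1 / t) ^ δ ≤ 1 + δ * (1 / t) :=
    rpow_one_add_le_one_add_mul_self (by have : 0 < 1 / t := by positivity
                                         linarith) h0 h1
  rw [h2, Real.mul_rpow ht.le (by positivity), Real.rpow_neg (x := 1 + 1 / t) (by positivity)]
  refine mul_le_mul_of_nonneg_left ?_ (by positivity)
  have h4 : 0 < (1 + 1 / t) ^ δ := by positivity
  have h5 : 0 ≤ δ / t := by positivity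
  have h6 : δ * (1 / t) = δ / t := by ring
  rw [h6] at h3
  refine le_trans ?_ (inv_anti₀ h4 h3)
  rw [← one_div, le_div_iff₀ (by positivity)]
  nlinarith

/-- The exponent makes the power decay at relative rate 1/(5D), well below the contraction rate
D/((D+1)(D+3)). Since `D * z ≥ 4`, the surplus, multiplied by 10, absorbs the additive error. -/
theorem recurrence_bound {m t : ℝ} (hm : 2 ≤ m) (ht : 1 ≤ t) {D : ℝ} (hD : D = 2 * m * t) :
    (1 - D / ((D + 1) * (D + 3))) * (10 * t ^ (-(1 / (10 * m)))) + 3 / ((D + 1) * (D + 3)) ≤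
      10 * (t + 1) ^ (-(1 / (10 * m))) := by
  have hm0 : 0 < m := by linarith
  have ht0 : 0 < t := by linarith
  have hδ : 1 / (10 * m) ≤ 1 := by
    rw [div_le_one (by positivity)]
    linarith
  have h1 := rpow_neg_mul_one_sub_le ht0 (by positivity : 0 ≤ 1 / (10 * m)) hδ
  have hz : 1 / t ≤ t ^ (-(1 / (10 * m))) := by
    rw [one_div, ← Real.rpow_neg_one]
    exact Real.rpow_le_rpow_of_exponent_le ht (by linarith)
  set z := t ^ (-(1 / (10 * m)))
  have hD4 : 4 ≤ D := by nlinarith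
  have hδt : 1 / (10 * m) / t = 1 / (5 * D) := by
    rw [hD]
    field_simp
    norm_num
  rw [hδt] at h1
  have hDz : 4 ≤ D * z := by
    have h2 : D * (1 / t) = 2 * m := by
      rw [hD]
      field_simp
    have h3 : D * (1 / t) ≤ D * z := mul_le_mul_of_nonneg_left hz (by linarith)
    linarith
  have hz0 : 0 ≤ z := by positivity
  have key : 3 / ((D + 1) * (D + 3)) ≤ 10 * z * (D / ((D + 1) * (D + 3)) - 1 / (5 * D)) := by
    have h2 : 10 * z * (D / ((D + 1) * (D + 3)) - 1 / (5 * D)) =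
        (z * (10 * D - 2 * ((D + 1) * (D + 3)) / D)) / ((D + 1) * (D + 3)) := by
      field_simp
      ring
    rw [h2]
    gcongr
    have h3 : 2 * ((D + 1) * (D + 3)) / D ≤ 5 * D := by
      rw [div_le_iff₀ (by linarith)]
      nlinarith
    nlinarith
  nlinarith

theorem expect_excess_le {m n : ℕ} (hm : 1 < m) (hn : 0 < n) :
    expect (prefGraph m n) (fun G => (excess n G : ℝ≥0∞)) ≤
      ENNReal.ofReal (10 * (n : ℝ) ^ (-(1 / (10 * (m : ℝ))))) := by
  obtain ⟨k, rfl⟩ := Nat.exists_eq_add_of_le' hm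
  have hm2 : (2 : ℝ) ≤ ((k + 2 : ℕ) : ℝ) := by exact_mod_cast hm
  induction n, hn using Nat.le_induction with
  | base => simp [excess_one, expect_const]
  | succ n hn ih =>
    set D : ℝ := 2 * ((k + 2 : ℕ) : ℝ) * n with hD
    have hD0 : 0 ≤ D := by positivity
    have ha : 0 ≤ 1 - D / ((D + 1) * (D + 3)) := by
      rw [sub_nonneg, div_le_one (by positivity)]
      nlinarith
    rw [prefGraph, expect_bind]
    refine (expect_mono (g := fun G => ENNReal.ofReal (1 - D / ((D + 1) * (D + 3))) * excess n G +
      ENNReal.ofReal (3 / ((D + 1) * (D + 3)))) fun G hG => ?_).trans ?_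
    · obtain ⟨hc, hmem⟩ := halfEdges_of_mem_support_prefGraph (Nat.zero_lt_of_lt hm) hG
      refine (expect_addEdges_excess_succ_le hn hmem (D := D) (by rw [hc, hD]; push_cast; rfl)).trans
        (le_of_eq ?_)
      rw [ENNReal.ofReal_add (by positivity) (by positivity), ENNReal.ofReal_mul ha,
        ENNReal.ofReal_natCast]
    · rw [expect_add, expect_const, expect_const_mul]
      refine (add_le_add_left (mul_le_mul_right ih _) _).trans ?_
      rw [← ENNReal.ofReal_mul ha, ← ENNReal.ofReal_add (by positivity) (by positivity)]
      refine ENNReal.ofReal_le_ofReal ?_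
      have := recurrence_bound hm2 (by exact_mod_cast hn : (1 : ℝ) ≤ n) hD
      push_cast at this ⊢
      exact this

/-! ### From expectation to probability, and the final comparison -/

theorem probConnected_le_one (m n : ℕ) : probConnected m n ≤ 1 := by
  refine ENNReal.toReal_le_of_le_ofReal zero_le_one ?_
  rw [ENNReal.ofReal_one, PMF.toOuterMeasure_apply, ← (prefGraph m n).tsum_coe]
  exact ENNReal.tsum_le_tsum fun G => Set.indicator_le_self _ _ _

theorem one_sub_probConnected_le {m n : ℕ} (hm : 1 < m) (hn : 0 < n) :
    1 - probConnected m n ≤ 10 * (n : ℝ) ^ (-(1 / (10 * (m : ℝ)))) := by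
  -- Markov's inequality: on the support, a disconnected graph has excess at least 1.
  have h1 : (1 : ℝ≥0∞) ≤ (prefGraph m n).toOuterMeasure {G | (adjGraph n G).Connected} +
      expect (prefGraph m n) (fun G => (excess n G : ℝ≥0∞)) := by
    rw [PMF.toOuterMeasure_apply, expect, ← ENNReal.tsum_add, ← (prefGraph m n).tsum_coe]
    refine ENNReal.tsum_le_tsum fun G => ?_
    by_cases hG : (adjGraph n G).Connected
    · rw [Set.indicator_of_mem (by exact hG)]
      exact le_self_add
    · by_cases hs : G ∈ (prefGraph m n).support
      · obtain ⟨-, hmem⟩ := halfEdges_of_mem_support_prefGraph (Nat.zero_lt_of_lt hm) hs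
        have h0 : excess n G ≠ 0 :=
          fun h0 => hG (connected_of_excess_eq_zero hn (fun u hu => (hmem u).1 hu) h0)
        refine le_add_left (le_mul_of_one_le_right' ?_)
        exact_mod_cast Nat.one_le_iff_ne_zero.2 h0
      · rw [(PMF.apply_eq_zero_iff _ _).2 hs]
        simp
  have hle : (prefGraph m n).toOuterMeasure {G | (adjGraph n G).Connected} ≠ ∞ := by
    refine ne_top_of_le_ne_top ENNReal.one_ne_top ?_
    rw [PMF.toOuterMeasure_apply, ← (prefGraph m n).tsum_coe]
    exact ENNReal.tsum_le_tsum fun G => Set.indicator_le_self _ _ _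
  have h2 := h1.trans (add_le_add_right (expect_excess_le hm hn) _)
  have h3 := ENNReal.toReal_mono (ENNReal.add_ne_top.2 ⟨hle, ENNReal.ofReal_ne_top⟩) h2
  rw [ENNReal.toReal_add hle ENNReal.ofReal_ne_top, ENNReal.toReal_ofReal (by positivity),
    ENNReal.toReal_one] at h3
  rw [probConnected]
  linarith

end PrefAttach

theorem mainTheorem3 (m : ℕ) (hm : 1 < m) (ε : ℝ) (hε : 0 < ε) :
    (fun n : ℕ => 1 - PrefAttach.probConnected m n) =O[atTop]
      (fun n : ℕ => (Real.log (Real.log (n : ℝ)) ^ (1 + ε) / Real.log (n : ℝ)) ^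
        (((m : ℝ) - 1) / 3)) := by
  have hm1 : (1 : ℝ) < m := by exact_mod_cast hm
  set A : ℝ := ((m : ℝ) - 1) / 3 with hA
  have hA0 : 0 ≤ A := by
    rw [hA]
    linarith
  set δ : ℝ := 1 / (10 * (m : ℝ)) with hδ
  have hδ0 : 0 < δ := by positivity
  have hlog : Tendsto (fun n : ℕ => Real.log (n : ℝ)) atTop atTop :=
    Real.tendsto_log_atTop.comp tendsto_natCast_atTop_atTop
  have hbound := ((isLittleO_log_rpow_rpow_atTop A hδ0).comp_tendsto
    (tendsto_natCast_atTop_atTop (R := ℝ))).bound zero_lt_one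
  refine IsBigO.of_bound 10 ?_
  filter_upwards [hbound, eventually_gt_atTop 0, hlog.eventually_gt_atTop 0,
    (Real.tendsto_log_atTop.comp hlog).eventually_ge_atTop 1] with n h1 hn h2 h3
  simp only [Function.comp_apply, one_mul] at h1 h3
  rw [Real.norm_of_nonneg (by positivity), Real.norm_of_nonneg (by positivity)] at h1
  -- The iterated logarithm only helps: the bound already holds with this factor replaced by 1.
  have h4 : (1 : ℝ) ≤ Real.log (Real.log n) ^ (1 + ε) :=
    Real.one_le_rpow h3 (by positivity)
  rw [Real.norm_of_nonneg (sub_nonneg.2 (PrefAttach.probConnected_le_one m n)),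
    Real.norm_of_nonneg (by positivity)]
  refine (PrefAttach.one_sub_probConnected_le hm hn).trans ?_
  refine mul_le_mul_of_nonneg_left ?_ (by norm_num)
  calc (n : ℝ) ^ (-δ) = ((n : ℝ) ^ δ)⁻¹ := Real.rpow_neg (by positivity) _
    _ ≤ (Real.log n ^ A)⁻¹ := inv_anti₀ (by positivity) h1
    _ = (1 / Real.log n) ^ A := by rw [one_div, Real.inv_rpow h2.le]
    _ ≤ _ := Real.rpow_le_rpow (by positivity) (by gcongr) hA0
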